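/- Let $X$ be a finite simplicial complex on a finite totally ordered vertex set $V$ (a collection of nonempty subsets of $V$ that contains every $\{v\}$, $v\in V$, and is closed under passing to nonempty subsets). Let $X_k$ be the set of its $k$-simplices, $f_k(X)=|X_k|$, and $X^{(k)}$ its $k$-skeleton. Let $H_k$ denote reduced simplicial homology with integer coefficients, that is, the homology of the chain complex augmented by $C_{-1}=\mathbb Z$, and let $\beta_k$ be the rank of $H_k$. Let $\partial_k$ be the matrix of the $k$-th boundary map in the bases of simplices oriented by the order of $V$. For $k\ge 0$ and $S\subset X_k$ put $X_S=S\sqcup X^{(k-1)}$. The set $S$ is a *$k$-spanning acycle* if $H_k(X_S)=0$ and $H_{k-1}(X_S)$ is finite; $\mathcal S^{(k)}$ is the set of all $k$-spanning acycles of $X$. Put $\gamma_k(X)=f_k(X^{(k)})-\beta_k(X^{(k)})+\beta_{k-1}(X^{(k)})$. Let $1\le d\le\dim X$, let $x=(x_\sigma)_{\sigma\in X_{d-1}}$ and $y=(y_\eta)_{\eta\in X_d}$ be indeterminates, and put $\partial_d(x,y)=\mathrm{diag}(x)\,\partial_d\,\mathrm{diag}(y)$. For $K\subset X_{d-1}$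 let $\partial_d(x,y)_K$ be the submatrix of the rows indexed by $K$; write $x_K=\prod_{\sigma\in K}x_\sigma$, and $y_S=\prod_{\eta\in S}y_\eta$ for $S\subset X_d$. **Theorem.** Let $K\subset X_{d-1}$ with $|K|=\gamma_d(X)$, and suppose that $L=X_{d-1}\setminus K$ is a $(d-1)$-spanning acycle. Then $H_{d-2}(X_S)$ is finite for every $S\in\mathcal S^{(d)}$ (the groups $H_{d-1}(X_S)$ and $H_{d-2}(X_L)$ are finite by definition), and $$\det\bigl(\partial_d(x,y)_K\,\partial_d(x,y)_K^{t}\bigr)=\sum_{S\in\mathcal S^{(d)}}\left(\frac{|H_{d-1}(X_S)|\cdot|H_{d-2}(X_L)|}{|H_{d-2}(X_S)|}\right)^{2}x_K^{2}\,y_S^{2}$$ as polynomials in the indeterminates $x,y$ with rational coefficients. -/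

import Mathlib

namespace PreAbstractSimplicialComplex

variable {V : Type*} [LinearOrder V]

/-- The incidence number of `τ` in `∂⟨σ⟩`: if `σ = {v₀ < ⋯ < v_k}`, it is `(-1)^j` when
`τ = σ \ {v_j}` (`j` counts the vertices of `σ` below `v_j`), and `0` if `τ` is not of this form. -/
def incidence (τ σ : Finset V) : ℤ :=
  ∑ v ∈ σ with τ = σ.erase v, (-1) ^ (σ.filter (· < v)).card

theorem incidence_comp (ρ σ : Finset V) :
    ∑ v ∈ σ, (-1 : ℤ) ^ (σ.filter (· < v)).card * incidence ρ (σ.erase v) = 0 := by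
  simp only [incidence, Finset.mul_sum, Finset.sum_filter]
  rw [Finset.sum_sigma']
  refine Finset.sum_involution (fun p _ => ⟨p.2, p.1⟩) ?_ ?_ ?_ ?_
  · rintro ⟨v, w⟩ h
    simp only [Finset.mem_sigma, Finset.mem_erase] at h
    obtain ⟨hv, hwv, hw⟩ := h
    dsimp only
    rw [Finset.erase_right_comm (a := w) (b := v)]
    have key : ∀ a b : V, a ∈ σ → b ∈ σ → a < b →
        (((σ.erase a).filter (· < b)).card + 1 = (σ.filter (· < b)).card) ∧
        (((σ.erase b).filter (· < a)).card = (σ.filter (· < a)).card) := by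
      intro a b ha hb hab
      constructor
      · rw [Finset.filter_erase, Finset.card_erase_add_one]
        simp [ha, hab]
      · rw [Finset.filter_erase, Finset.erase_eq_of_notMem]
        simp [hab.le]
    split_ifs with hρ
    · rcases lt_or_gt_of_ne hwv with hlt | hlt
      · obtain ⟨h1, h2⟩ := key w v hw hv hlt
        rw [h2, ← h1]; ring
      · obtain ⟨h1, h2⟩ := key v w hv hw hlt
        rw [h2, ← h1]; ring
    · simp
  · rintro ⟨v, w⟩ h _ heq
    simp only [Finset.mem_sigma, Finset.mem_erase] at h
    simp only [Sigma.mk.injEq] at heq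
    exact h.2.1 heq.1
  · rintro ⟨v, w⟩ h
    simp only [Finset.mem_sigma, Finset.mem_erase] at h ⊢
    exact ⟨h.2.2, h.2.1.symm, h.1⟩
  · rintro ⟨v, w⟩ h
    rfl

variable [Fintype V]

/-- The set `X_k` of `k`-simplices: the faces with `k + 1` vertices. For `k = -1` it is `{∅}`
(the empty simplex of the augmented chain complex), for `k < -1` it is empty. -/
noncomputable def simplices (X : PreAbstractSimplicialComplex V) (k : ℤ) : Finset (Finset V) :=
  open Classical in {σ | (σ ∈ X.faces ∨ σ = ∅) ∧ (σ.card : ℤ) = k + 1}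

theorem mem_simplices (X : PreAbstractSimplicialComplex V) {k : ℤ} {σ : Finset V} :
    σ ∈ X.simplices k ↔ (σ ∈ X.faces ∨ σ = ∅) ∧ (σ.card : ℤ) = k + 1 := by
  simp [simplices]

/-- The dimension: the maximal dimension of a face (`-1` if there is no face). -/
noncomputable def dim (X : PreAbstractSimplicialComplex V) : ℤ :=
  open Classical in
  ((({σ | σ ∈ X.faces} : Finset (Finset V)).sup Finset.card : ℕ) : ℤ) - 1

/-- The matrix, in the bases of oriented simplices, of the boundary map from `k`-chains to
`l`-chains; it is used with `l = k - 1` only. -/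
noncomputable def boundaryMatrix (X : PreAbstractSimplicialComplex V) (l k : ℤ) :
    Matrix (X.simplices l) (X.simplices k) ℤ :=
  Matrix.of fun τ σ => incidence (τ : Finset V) (σ : Finset V)

/-- `∂_k ∂_{k+1} = 0`. -/
theorem boundaryMatrix_mul (X : PreAbstractSimplicialComplex V) (k : ℤ) :
    X.boundaryMatrix (k - 1) k * X.boundaryMatrix k (k + 1) = 0 := by
  ext ρ σ
  rw [Matrix.mul_apply, Matrix.zero_apply, ← incidence_comp (ρ : Finset V) (σ : Finset V)]
  simp only [boundaryMatrix, Matrix.of_apply]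
  rw [Finset.sum_coe_sort (X.simplices k) (fun τ => incidence (ρ : Finset V) τ * incidence τ σ)]
  have hτ : ∀ τ, incidence (ρ : Finset V) τ * incidence τ σ = ∑ v ∈ (σ : Finset V),
      if τ = (σ : Finset V).erase v then
        (-1 : ℤ) ^ ((σ : Finset V).filter (· < v)).card * incidence ρ τ else 0 := by
    intro τ
    rw [incidence.eq_1 τ, Finset.mul_sum, Finset.sum_filter]
    exact Finset.sum_congr rfl fun v _ => by split_ifs <;> ring
  simp only [hτ]
  rw [Finset.sum_comm]
  refine Finset.sum_congr rfl fun v hv => ?_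
  rw [Finset.sum_ite_eq', if_pos]
  obtain ⟨h1, h2⟩ := X.mem_simplices.mp σ.2
  refine X.mem_simplices.mpr ⟨?_, ?_⟩
  · rcases Finset.eq_empty_or_nonempty ((σ : Finset V).erase v) with h | h
    · exact Or.inr h
    · refine Or.inl ((X.isRelLowerSet_faces (h1.resolve_right ?_)).2 (Finset.erase_subset _ _) h)
      rintro h0
      rw [h0] at hv
      simp at hv
  · have := Finset.card_erase_add_one hv
    omega

/-- The boundary map of the augmented integral chain complex, `C_k(X) = ℤ^{X_k}`. -/
noncomputable def boundary (X : PreAbstractSimplicialComplex V) (l k : ℤ) :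
    (X.simplices k → ℤ) →ₗ[ℤ] (X.simplices l → ℤ) :=
  (X.boundaryMatrix l k).mulVecLin

/-- `Z_k(X) = ker ∂_k`. -/
noncomputable def cycles (X : PreAbstractSimplicialComplex V) (k : ℤ) : Submodule ℤ (X.simplices k → ℤ) :=
  LinearMap.ker (X.boundary (k - 1) k)

/-- `B_k(X) = im ∂_{k+1}`. -/
noncomputable def boundaries (X : PreAbstractSimplicialComplex V) (k : ℤ) : Submodule ℤ (X.simplices k → ℤ) :=
  LinearMap.range (X.boundary k (k + 1))

theorem boundaries_le_cycles (X : PreAbstractSimplicialComplex V) (k : ℤ) :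
    X.boundaries k ≤ X.cycles k := by
  rintro _ ⟨c, rfl⟩
  simp [cycles, boundary, Matrix.mulVec_mulVec, boundaryMatrix_mul]

/-- The reduced integral homology `H_k(X) = Z_k(X) / B_k(X)`. -/
abbrev Homology (X : PreAbstractSimplicialComplex V) (k : ℤ) : Type _ :=
  X.cycles k ⧸ (X.boundaries k).submoduleOf (X.cycles k)

/-- The Betti number `β_k(X)`: the rank of the abelian group `H_k(X)`. -/
noncomputable def betti (X : PreAbstractSimplicialComplex V) (k : ℤ) : ℕ :=
  Module.finrank ℤ (X.Homology k)

/-- The `k`-skeleton `X^{(k)}`: all faces of dimension at most `k`. -/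
def skeleton (X : PreAbstractSimplicialComplex V) (k : ℤ) : PreAbstractSimplicialComplex V where
  faces := {σ | σ ∈ X.faces ∧ (σ.card : ℤ) ≤ k + 1}
  isRelLowerSet_faces := by
    intro σ hσ
    refine ⟨(X.isRelLowerSet_faces hσ.1).1, fun τ hτ hne => ?_⟩
    have hτ' : τ ⊆ σ := hτ
    exact ⟨(X.isRelLowerSet_faces hσ.1).2 hτ hne,
      le_trans (by exact_mod_cast Finset.card_le_card hτ') hσ.2⟩

/-- The subcomplex `X_S = S ⊔ X^{(k-1)}` for a set `S` of `k`-simplices, `k ≥ 0`. -/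
def faceSubcomplex (X : PreAbstractSimplicialComplex V) (k : ℤ) (S : Finset (X.simplices k)) :
    PreAbstractSimplicialComplex V where
  faces := {σ | σ ∈ X.faces ∧ ((σ.card : ℤ) ≤ k ∨ ∃ η ∈ S, (η : Finset V) = σ)}
  isRelLowerSet_faces := by
    intro σ hσ
    refine ⟨(X.isRelLowerSet_faces hσ.1).1, fun τ hτ hne => ?_⟩
    have hτ' : τ ⊆ σ := hτ
    refine ⟨(X.isRelLowerSet_faces hσ.1).2 hτ hne, ?_⟩
    rcases hσ.2 with h | ⟨η, hη, rfl⟩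
    · exact Or.inl (le_trans (by exact_mod_cast Finset.card_le_card hτ') h)
    · rcases eq_or_ne τ η with rfl | hn
      · exact Or.inr ⟨η, hη, rfl⟩
      · left
        have h1 := Finset.card_lt_card (hτ'.ssubset_of_ne hn)
        have h2 := ((X.mem_simplices).mp η.2).2
        omega

/-- A `k`-spanning acycle: a set `S` of `k`-simplices with `H_k(X_S) = 0` and `H_{k-1}(X_S)`
finite. -/
def IsSpanningAcycle (X : PreAbstractSimplicialComplex V) (k : ℤ)
    (S : Finset (X.simplices k)) : Prop :=
  Subsingleton ((X.faceSubcomplex k S).Homology k) ∧ Finite ((X.faceSubcomplex k S).Homology (k - 1))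

/-- The set `𝒮^{(k)}` of `k`-spanning acycles. -/
noncomputable def spanningAcycles (X : PreAbstractSimplicialComplex V) (k : ℤ) :
    Finset (Finset (X.simplices k)) :=
  open Classical in {S | X.IsSpanningAcycle k S}

/-- `γ_k(X) = f_k(X^{(k)}) - β_k(X^{(k)}) + β_{k-1}(X^{(k)})`. -/
noncomputable def gamma (X : PreAbstractSimplicialComplex V) (k : ℤ) : ℤ :=
  ((X.skeleton k).simplices k).card - (X.skeleton k).betti k + (X.skeleton k).betti (k - 1)

/-- The indeterminates: one `x_σ` for each `(k-1)`-simplex and one `y_η` for each `k`-simplex. -/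
abbrev Indet (X : PreAbstractSimplicialComplex V) (k : ℤ) : Type _ :=
  X.simplices (k - 1) ⊕ X.simplices k

/-- The indeterminate `x_σ`. -/
noncomputable def xVar (X : PreAbstractSimplicialComplex V) (k : ℤ) (σ : X.simplices (k - 1)) :
    MvPolynomial (X.Indet k) ℚ := MvPolynomial.X (Sum.inl σ)

/-- The indeterminate `y_η`. -/
noncomputable def yVar (X : PreAbstractSimplicialComplex V) (k : ℤ) (η : X.simplices k) :
    MvPolynomial (X.Indet k) ℚ := MvPolynomial.X (Sum.inr η)

/-- The weighted boundary matrix `∂_k(x, y) = diag(x) ∂_k diag(y)`. -/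
noncomputable def weightedBoundary (X : PreAbstractSimplicialComplex V) (k : ℤ) :
    Matrix (X.simplices (k - 1)) (X.simplices k) (MvPolynomial (X.Indet k) ℚ) :=
  Matrix.diagonal (X.xVar k) *
    (X.boundaryMatrix (k - 1) k).map (Int.cast : ℤ → MvPolynomial (X.Indet k) ℚ) *
    Matrix.diagonal (X.yVar k)

/-- The submatrix `∂_k(x, y)_K` of the rows indexed by `K`. -/
noncomputable def weightedBoundaryRows (X : PreAbstractSimplicialComplex V) (k : ℤ)
    (K : Finset (X.simplices (k - 1))) :
    Matrix K (X.simplices k) (MvPolynomial (X.Indet k) ℚ) :=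
  (X.weightedBoundary k).submatrix (fun σ => (σ : X.simplices (k - 1))) id

end PreAbstractSimplicialComplex

/-! Cauchy–Binet expands the determinant over the sets `S` of `|K|` columns, so only the absolute
value of each minor of `∂_d` on `K × S` is needed. It is the index in `ℤ^K` of `r(B_S)`, where `B_S`
is spanned by the boundaries of the simplices in `S` and `r` restricts chains to `K`. The index is
computed along `r(B_S) ≤ r(Z) ≤ ℤ^K` with `Z = Z_{d-1}(X)`. As `L` carries no nonzero cycle, `r` is
injective on `Z`, and the first step has index `[Z : B_S] = |H_{d-1}(X_S)|`. By the symmetry in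
`AddSubgroup.relIndex_map_inf_ker_comm`, the second has index `[∂C_{d-1}(X) : ∂C_{d-1}(X_L)]`, which
is `|H_{d-2}(X_L)| / |H_{d-2}(X_S)|` because `X_S` contains the whole `(d-1)`-skeleton.

A minor is nonzero exactly when `S` is a spanning acycle, and a rank count shows that every spanning
acycle has `|K|` elements. All groups are placed inside `Finset V → ℤ`, so that chains of different
subcomplexes can be compared as subgroups. -/

theorem Finset.exists_injective_image_univ_eq {α β : Type*} [Fintype α] [DecidableEq β]
    (S : Finset β)
    (h : S.card = Fintype.card α) :
    ∃ e : α → β, Function.Injective e ∧ Finset.univ.image e = S := by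
  have e : α ≃ S := Fintype.equivOfCardEq (by simp [h])
  refine ⟨fun a => e a, Subtype.val_injective.comp e.injective, ?_⟩
  ext b
  simp only [Finset.mem_image, Finset.mem_univ, true_and]
  exact ⟨fun ⟨a, ha⟩ => ha ▸ (e a).2, fun hb => ⟨e.symm ⟨b, hb⟩, by simp⟩⟩

/-! ### Cauchy–Binet, and the determinant as an index -/

namespace Matrix

/-- Multilinearity in the columns: column `i` of `A * B` is the combination of the columns of `A`
with coefficients `B j i`. -/
theorem det_mul_eq_sum_prod_mul_det {m n R : Type*} [Fintype m] [DecidableEq m] [Fintype n]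
    [CommRing R] (A : Matrix m n R) (B : Matrix n m R) :
    (A * B).det = ∑ p : m → n, (∏ i, B (p i) i) * (A.submatrix id p).det := by
  classical
  simp only [det_apply', mul_apply, Finset.prod_univ_sum, Finset.mul_sum, Fintype.piFinset_univ]
  rw [Finset.sum_comm]
  refine Finset.sum_congr rfl fun p _ => Finset.sum_congr rfl fun σ _ => ?_
  simp only [Finset.prod_mul_distrib, submatrix_apply, id]
  ring

/-- The Cauchy–Binet formula; `g S` is the product of the minors with columns, respectively rows,
in `S`, which does not depend on the enumeration of `S`. -/
theorem det_mul_eq_sum_powersetCard {m n R : Type*} [Fintype m] [DecidableEq m] [Fintype n]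
    [DecidableEq n] [CommRing R] (A : Matrix m n R) (B : Matrix n m R) (g : Finset n → R)
    (hg : ∀ e : m → n, Function.Injective e →
      (A.submatrix id e).det * (B.submatrix e id).det = g (Finset.univ.image e)) :
    (A * B).det = ∑ S ∈ Finset.powersetCard (Fintype.card m) (Finset.univ : Finset n), g S := by
  rw [det_mul_eq_sum_prod_mul_det]
  have h0 : ∀ p : m → n, ¬ Function.Injective p → (A.submatrix id p).det = 0 := by
    intro p hp
    simp only [Function.Injective, not_forall] at hp
    obtain ⟨i, j, hij, hne⟩ := hp
    exact det_zero_of_column_eq hne fun k => by simp [hij]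
  rw [← Finset.sum_subset (Finset.subset_univ
    (Finset.univ.filter fun p : m → n => Function.Injective p))
    fun p _ hp => by rw [h0 p (by simpa using hp), mul_zero]]
  have hmaps : ∀ p ∈ Finset.univ.filter (fun p : m → n => Function.Injective p),
      Finset.univ.image p ∈ Finset.powersetCard (Fintype.card m) (Finset.univ : Finset n) := by
    intro p hp
    rw [Finset.mem_powersetCard]
    exact ⟨Finset.subset_univ _, Finset.card_image_of_injective _ (by simpa using hp)⟩
  rw [← Finset.sum_fiberwise_of_maps_to hmaps]
  refine Finset.sum_congr rfl fun S hS => ?_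
  obtain ⟨e, hinj, himg⟩ :=
    Finset.exists_injective_image_univ_eq S (Finset.mem_powersetCard.mp hS).2
  have hB : (B.submatrix e id).det =
      ∑ τ : Equiv.Perm m, (Equiv.Perm.sign τ : R) * ∏ i, B (e (τ i)) i := det_apply' _
  have hgS := hg e hinj
  rw [himg] at hgS
  rw [← hgS, hB, Finset.mul_sum]
  symm
  -- The injections with image `S` are the `e ∘ τ`; the sign by which `τ` changes the minor of `A`
  -- is the one in the Leibniz formula for the minor of `B`.
  refine Finset.sum_bij (fun (τ : Equiv.Perm m) _ => e ∘ τ) ?_ ?_ ?_ ?_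
  · intro τ _
    simp only [Finset.mem_filter, Finset.mem_univ, true_and]
    refine ⟨hinj.comp τ.injective, ?_⟩
    rw [← Finset.image_image, Finset.image_univ_equiv, himg]
  · intro τ _ τ' _ h
    exact Equiv.ext fun i => hinj (congrFun h i)
  · intro p hp
    simp only [Finset.mem_filter, Finset.mem_univ, true_and] at hp
    obtain ⟨hp, hpS⟩ := hp
    have hex : ∀ i, ∃ j, e j = p i := by
      intro i
      have : p i ∈ Finset.univ.image e := by
        rw [himg, ← hpS]; exact Finset.mem_image_of_mem _ (Finset.mem_univ _)
      simpa using this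
    choose t ht using hex
    have htinj : Function.Injective t := fun i j hij => hp (by rw [← ht, ← ht, hij])
    exact ⟨Equiv.ofBijective t (Finite.injective_iff_bijective.mp htinj), Finset.mem_univ _,
      funext ht⟩
  · intro τ _
    have : (A.submatrix id (e ∘ τ)).det
        = (Equiv.Perm.sign τ : R) * (A.submatrix id e).det := by
      rw [← det_permute' τ (A.submatrix id e), submatrix_submatrix, Function.id_comp]
    rw [this]
    simp only [Function.comp]
    ring

/-- The image of a square integer matrix has index the absolute value of the determinant
(both are `0` for an infinite index). -/
theorem index_range_mulVecLin {ι : Type*} [Fintype ι] [DecidableEq ι] (N : Matrix ι ι ℤ) :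
    (LinearMap.range N.mulVecLin).toAddSubgroup.index = N.det.natAbs := by
  by_cases hN : N.det = 0
  · rw [hN, Int.natAbs_zero]
    by_contra hne
    have hfin : (LinearMap.range N.mulVecLin).toAddSubgroup.FiniteIndex := ⟨hne⟩
    -- A range of finite index has full rank, so the kernel would have rank `0`, against the null
    -- vector of a singular matrix.
    have h1 := (LinearMap.range N.mulVecLin).toAddSubgroup.finrank_eq_of_finiteIndex
    have h2 := Submodule.finrank_quotient_add_finrank (LinearMap.ker N.mulVecLin)
    rw [N.mulVecLin.quotKerEquivRange.finrank_eq] at h2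
    have h3 : Module.finrank ℤ (LinearMap.range N.mulVecLin) = Module.finrank ℤ (ι → ℤ) := h1
    have h4 : Module.finrank ℤ (LinearMap.ker N.mulVecLin) = 0 := by omega
    rw [Submodule.finrank_eq_zero] at h4
    obtain ⟨v, hv, hNv⟩ := exists_mulVec_eq_zero_iff.mpr hN
    have : v ∈ LinearMap.ker N.mulVecLin := hNv
    rw [h4] at this
    exact hv this
  · have hinj : Function.Injective N.mulVecLin := by
      rw [← LinearMap.ker_eq_bot, LinearMap.ker_eq_bot']
      intro v hv
      exact eq_zero_of_mulVec_eq_zero hN hv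
    have h := Submodule.natAbs_det_equiv _ (LinearEquiv.ofInjective N.mulVecLin hinj)
    have h2 : (LinearMap.range N.mulVecLin).subtype ∘ₗ AddMonoidHom.toIntLinearMap
        ((LinearEquiv.ofInjective N.mulVecLin hinj : (ι → ℤ) ≃ₗ[ℤ] _) : (ι → ℤ) →+ _)
        = N.mulVecLin := by
      ext; rfl
    erw [h2] at h
    rw [← toLin'_apply', LinearMap.det_toLin'] at h
    exact h.symm

end Matrix

/-! ### Relative indices of images -/

namespace AddSubgroup

variable {G G₁ G₂ : Type*} [AddCommGroup G] [AddCommGroup G₁] [AddCommGroup G₂]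

/-- `f(K) / f(H)` is `K / (H + K ∩ ker f)`; the modular law gives this form of the denominator. -/
theorem relIndex_map_map_eq_relIndex_sup (f : G →+ G₁) {H K : AddSubgroup G} (h : H ≤ K) :
    (H.map f).relIndex (K.map f) = (H ⊔ K ⊓ f.ker).relIndex K := by
  have h1 : K ⊔ f.ker = K ⊔ (H ⊔ f.ker) := by rw [← sup_assoc, sup_eq_left.mpr h]
  rw [relIndex_map_map, h1, relIndex_sup_right, ← inf_relIndex_right, sup_inf_assoc_of_le _ h,
    inf_comm]

theorem relIndex_map_map_of_disjoint_ker (f : G →+ G₁) {H K : AddSubgroup G} (h : H ≤ K)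
    (hd : K ⊓ f.ker = ⊥) : (H.map f).relIndex (K.map f) = H.relIndex K := by
  rw [relIndex_map_map_eq_relIndex_sup f h, hd, sup_bot_eq]

/-- Both quotients are `P / (P ∩ ker f + P ∩ ker g)`, which is symmetric in `f` and `g`. -/
theorem relIndex_map_inf_ker_comm (f : G →+ G₁) (g : G →+ G₂) (P : AddSubgroup G) :
    ((P ⊓ f.ker).map g).relIndex (P.map g) = ((P ⊓ g.ker).map f).relIndex (P.map f) := by
  rw [relIndex_map_map_eq_relIndex_sup g inf_le_left,
    relIndex_map_map_eq_relIndex_sup f inf_le_left, sup_comm]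

end AddSubgroup

/-! ### Functions with prescribed support and extension by zero -/

/-- The functions that vanish outside `A`. -/
abbrev Pi.supported {α : Type*} (A : Finset α) : Submodule ℤ (α → ℤ) :=
  Submodule.pi (Aᶜ : Set α) fun _ => ⊥

theorem Pi.mem_supported {α : Type*} {A : Finset α} {f : α → ℤ} :
    f ∈ Pi.supported A ↔ ∀ a ∉ A, f a = 0 := by
  simp [Pi.supported, Submodule.mem_pi]

theorem Function.ExtendByZero.injective_linearMap {ι α : Type*} {j : ι → α}
    (hj : Function.Injective j) :
    Function.Injective (Function.ExtendByZero.linearMap ℤ j) := by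
  intro f g h
  funext i
  have := congrFun h (j i)
  simpa [hj.extend_apply] using this

theorem Function.ExtendByZero.range_linearMap {ι α : Type*} [Fintype ι] [DecidableEq α]
    {j : ι → α} (hj : Function.Injective j) :
    LinearMap.range (Function.ExtendByZero.linearMap ℤ j) =
      Pi.supported (Finset.univ.image j) := by
  ext f
  rw [Pi.mem_supported]
  constructor
  · rintro ⟨g, rfl⟩ a ha
    rw [Function.ExtendByZero.linearMap_apply, Function.extend_apply']
    · rfl
    · rintro ⟨i, rfl⟩
      exact ha (Finset.mem_image_of_mem _ (Finset.mem_univ i))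
  · intro h
    refine ⟨f ∘ j, funext fun a => ?_⟩
    rw [Function.ExtendByZero.linearMap_apply]
    by_cases ha : ∃ i, j i = a
    · obtain ⟨i, rfl⟩ := ha
      rw [hj.extend_apply]; rfl
    · rw [Function.extend_apply' _ _ _ ha, h a]
      · rfl
      · simpa using ha

theorem Pi.finrank_supported {α : Type*} [DecidableEq α] (A : Finset α) :
    Module.finrank ℤ (Pi.supported A) = A.card := by
  have h := Function.ExtendByZero.range_linearMap (Subtype.val_injective (p := (· ∈ A)))
  rw [Finset.univ_eq_attach, Finset.attach_image_val] at h
  rw [← h, LinearMap.finrank_range_of_inj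
    (Function.ExtendByZero.injective_linearMap Subtype.val_injective),
    Module.finrank_fintype_fun_eq_card, Fintype.card_coe]

theorem Matrix.mulVec_extendByZero {ι α β : Type*} [Fintype ι] [Fintype α] (M : Matrix β α ℤ)
    {j : ι → α} (hj : Function.Injective j) (f : ι → ℤ) :
    M.mulVec (Function.ExtendByZero.linearMap ℤ j f) = (M.submatrix id j).mulVec f := by
  classical
  funext b
  simp only [Matrix.mulVec, dotProduct, Matrix.submatrix_apply, id]
  rw [← Finset.sum_subset (Finset.subset_univ (Finset.univ.image j)), Finset.sum_image hj.injOn]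
  · simp [hj.extend_apply]
  · intro a _ ha
    rw [Function.ExtendByZero.linearMap_apply, Function.extend_apply', Pi.zero_apply, mul_zero]
    simpa using ha

/-! ### Homology orders as relative indices in one ambient group -/

namespace PreAbstractSimplicialComplex

variable {V : Type*} [LinearOrder V] [Fintype V]

/-- Closure under faces; this is what makes extension by zero commute with the boundary maps. -/
theorem incidence_eq_zero (X : PreAbstractSimplicialComplex V) {l k : ℤ} (h : l + 1 = k)
    {τ σ : Finset V} (hσ : σ ∈ X.simplices k) (hτ : τ ∉ X.simplices l) : incidence τ σ = 0 := by
  refine Finset.sum_eq_zero fun v hv => ?_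
  obtain ⟨hvσ, rfl⟩ := Finset.mem_filter.mp hv
  exfalso
  apply hτ
  obtain ⟨h1, h2⟩ := X.mem_simplices.mp hσ
  refine X.mem_simplices.mpr ⟨?_, ?_⟩
  · rcases Finset.eq_empty_or_nonempty (σ.erase v) with h | h
    · exact Or.inr h
    · refine Or.inl ((X.isRelLowerSet_faces (h1.resolve_right ?_)).2 (Finset.erase_subset _ _) h)
      rintro rfl
      simp at hvσ
  · have := Finset.card_erase_add_one hvσ
    omega

variable (V) in
/-- The boundary map on the free abelian group of all finite sets of vertices. -/
noncomputable def fullBoundary : (Finset V → ℤ) →ₗ[ℤ] (Finset V → ℤ) :=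
  (Matrix.of incidence).mulVecLin

/-- Extension by zero of a chain on the `k`-simplices. -/
noncomputable abbrev extendChain (X : PreAbstractSimplicialComplex V) (k : ℤ) :
    (X.simplices k → ℤ) →ₗ[ℤ] (Finset V → ℤ) :=
  Function.ExtendByZero.linearMap ℤ Subtype.val

theorem extendChain_injective (X : PreAbstractSimplicialComplex V) (k : ℤ) :
    Function.Injective (X.extendChain k) :=
  Function.ExtendByZero.injective_linearMap Subtype.val_injective

theorem range_extendChain (X : PreAbstractSimplicialComplex V) (k : ℤ) :
    LinearMap.range (X.extendChain k) = Pi.supported (X.simplices k) := by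
  rw [Function.ExtendByZero.range_linearMap Subtype.val_injective, Finset.univ_eq_attach,
    Finset.attach_image_val]

theorem fullBoundary_extendChain (X : PreAbstractSimplicialComplex V) {l k : ℤ} (h : l + 1 = k)
    (f : X.simplices k → ℤ) :
    fullBoundary V (X.extendChain k f) = X.extendChain l (X.boundary l k f) := by
  rw [fullBoundary, Matrix.mulVecLin_apply, Matrix.mulVec_extendByZero _ Subtype.val_injective]
  funext τ
  by_cases hτ : τ ∈ X.simplices l
  · exact (Subtype.val_injective.extend_apply (X.boundary l k f) 0 (⟨τ, hτ⟩ : X.simplices l)).symm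
  · rw [Function.ExtendByZero.linearMap_apply, Function.extend_apply' _ _ _ (by simpa using hτ)]
    refine Finset.sum_eq_zero fun σ _ => ?_
    simp [X.incidence_eq_zero h σ.2 hτ]

theorem map_cycles (X : PreAbstractSimplicialComplex V) (k : ℤ) :
    (X.cycles k).map (X.extendChain k) =
      Pi.supported (X.simplices k) ⊓ LinearMap.ker (fullBoundary V) := by
  have h : X.cycles k = (LinearMap.ker (fullBoundary V)).comap (X.extendChain k) := by
    ext f
    rw [Submodule.mem_comap, LinearMap.mem_ker,
      X.fullBoundary_extendChain (by omega : k - 1 + 1 = k),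
      (X.extendChain (k - 1)).map_eq_zero_iff (X.extendChain_injective _)]
    rfl
  rw [h, Submodule.map_comap_eq, range_extendChain]

theorem map_boundaries (X : PreAbstractSimplicialComplex V) (k : ℤ) :
    (X.boundaries k).map (X.extendChain k) =
      (Pi.supported (X.simplices (k + 1))).map (fullBoundary V) := by
  rw [boundaries, ← range_extendChain, ← LinearMap.range_comp, ← LinearMap.range_comp]
  congr 1
  exact LinearMap.ext fun f => (X.fullBoundary_extendChain rfl f).symm

variable (V) in
/-- The cycles supported on `A`. -/
noncomputable def cyclesOn (A : Finset (Finset V)) : AddSubgroup (Finset V → ℤ) :=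
  (Pi.supported A).toAddSubgroup ⊓ (fullBoundary V).toAddMonoidHom.ker

variable (V) in
/-- The boundaries of the chains supported on `A`. -/
noncomputable def boundariesOf (A : Finset (Finset V)) : AddSubgroup (Finset V → ℤ) :=
  (Pi.supported A).toAddSubgroup.map (fullBoundary V).toAddMonoidHom

/-- Valid for infinite homology too, where `Nat.card` and `relIndex` are both `0`; finiteness thus
becomes a nonvanishing index. -/
theorem card_homology (X : PreAbstractSimplicialComplex V) (k : ℤ) :
    Nat.card (X.Homology k) =
      (boundariesOf V (X.simplices (k + 1))).relIndex (cyclesOn V (X.simplices k)) := by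
  have h1 : cyclesOn V (X.simplices k) =
      (X.cycles k).toAddSubgroup.map (X.extendChain k).toAddMonoidHom :=
    congrArg Submodule.toAddSubgroup (X.map_cycles k).symm
  have h2 : boundariesOf V (X.simplices (k + 1)) =
      (X.boundaries k).toAddSubgroup.map (X.extendChain k).toAddMonoidHom :=
    congrArg Submodule.toAddSubgroup (X.map_boundaries k).symm
  rw [h1, h2, AddSubgroup.relIndex_map_map_of_injective _ _ (X.extendChain_injective k)]
  rfl

theorem simplices_faceSubcomplex_self (X : PreAbstractSimplicialComplex V) {k : ℤ} (hk : 0 ≤ k)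
    (S : Finset (X.simplices k)) :
    (X.faceSubcomplex k S).simplices k = S.map (Function.Embedding.subtype _) := by
  ext σ
  rw [mem_simplices, Finset.mem_map]
  constructor
  · rintro ⟨h, hc⟩
    rcases h with ⟨_, h | ⟨η, hη, rfl⟩⟩ | rfl
    · omega
    · exact ⟨η, hη, rfl⟩
    · simp at hc; omega
  · rintro ⟨η, hη, rfl⟩
    obtain ⟨h1, h2⟩ := X.mem_simplices.mp η.2
    refine ⟨h1.imp_left fun h => ⟨h, Or.inr ⟨η, hη, rfl⟩⟩, h2⟩

theorem simplices_faceSubcomplex_succ (X : PreAbstractSimplicialComplex V) {k : ℤ} (hk : 0 ≤ k)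
    (S : Finset (X.simplices k)) :
    (X.faceSubcomplex k S).simplices (k + 1) = ∅ := by
  rw [Finset.eq_empty_iff_forall_notMem]
  intro σ hσ
  obtain ⟨h, hc⟩ := mem_simplices _ |>.mp hσ
  rcases h with ⟨_, h | ⟨η, hη, rfl⟩⟩ | rfl
  · omega
  · have := (X.mem_simplices.mp η.2).2
    omega
  · simp at hc; omega

theorem simplices_faceSubcomplex_of_lt (X : PreAbstractSimplicialComplex V) {l k : ℤ} (h : l < k)
    (S : Finset (X.simplices k)) :
    (X.faceSubcomplex k S).simplices l = X.simplices l := by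
  ext σ
  simp only [mem_simplices]
  refine and_congr_left fun hc => or_congr_left ⟨fun h => h.1, fun h => ⟨h, Or.inl (by omega)⟩⟩

theorem boundariesOf_le_cyclesOn (X : PreAbstractSimplicialComplex V) {l k : ℤ} (h : l + 1 = k) :
    boundariesOf V (X.simplices k) ≤ cyclesOn V (X.simplices l) := by
  subst h
  have := Submodule.map_mono (f := X.extendChain l) (X.boundaries_le_cycles l)
  rw [X.map_cycles l, X.map_boundaries l] at this
  exact this

theorem boundariesOf_mono {A B : Finset (Finset V)} (h : A ⊆ B) :
    boundariesOf V A ≤ boundariesOf V B := by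
  refine AddSubgroup.map_mono fun f hf => ?_
  exact Pi.mem_supported.mpr fun a ha => Pi.mem_supported.mp hf a fun ha' => ha (h ha')

theorem card_homology_faceSubcomplex_pred (X : PreAbstractSimplicialComplex V) {l k : ℤ}
    (hk : 0 ≤ k) (h : l + 1 = k) (S : Finset (X.simplices k)) :
    Nat.card ((X.faceSubcomplex k S).Homology l) =
      (boundariesOf V (S.map (Function.Embedding.subtype _))).relIndex
        (cyclesOn V (X.simplices l)) := by
  subst h
  rw [card_homology, X.simplices_faceSubcomplex_of_lt (lt_add_one l),
    X.simplices_faceSubcomplex_self hk]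

theorem card_homology_faceSubcomplex_of_lt (X : PreAbstractSimplicialComplex V) {l m k : ℤ}
    (hm : l + 1 = m) (hk : m < k) (S : Finset (X.simplices k)) :
    Nat.card ((X.faceSubcomplex k S).Homology l) =
      (boundariesOf V (X.simplices m)).relIndex (cyclesOn V (X.simplices l)) := by
  rw [card_homology, simplices_faceSubcomplex_of_lt _ (by omega),
    simplices_faceSubcomplex_of_lt _ (by omega), hm]

theorem boundariesOf_empty : boundariesOf V (∅ : Finset (Finset V)) = ⊥ := by
  rw [boundariesOf, eq_bot_iff]
  rintro _ ⟨f, hf, rfl⟩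
  have : f = 0 := funext fun a => Pi.mem_supported.mp hf a (by simp)
  simp [this]

/-- `X_S` has no simplices above dimension `k`, so its `H_k` is the group of `k`-cycles itself. -/
theorem isSpanningAcycle_iff (X : PreAbstractSimplicialComplex V) {l k : ℤ} (hk : 0 ≤ k)
    (h : l + 1 = k) (S : Finset (X.simplices k)) :
    X.IsSpanningAcycle k S ↔
      cyclesOn V (S.map (Function.Embedding.subtype _)) = ⊥ ∧
      (boundariesOf V (S.map (Function.Embedding.subtype _))).relIndex
        (cyclesOn V (X.simplices l)) ≠ 0 := by
  obtain rfl : l = k - 1 := by omega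
  rw [IsSpanningAcycle]
  refine and_congr ?_ ?_
  · rw [← AddSubgroup.card_eq_one, ← AddSubgroup.relIndex_bot_left, ← boundariesOf_empty,
      ← X.simplices_faceSubcomplex_succ hk S, ← X.simplices_faceSubcomplex_self hk S,
      ← card_homology, Nat.card_eq_one_iff_unique]
    exact ⟨fun h => ⟨h, inferInstance⟩, fun h => h.1⟩
  · rw [← X.card_homology_faceSubcomplex_pred hk h, Nat.card_ne_zero]
    exact ⟨fun h => ⟨inferInstance, h⟩, fun h => h.2⟩

/-! ### Restriction to the rows in `K` and the minors -/

/-- The restriction of functions to the simplices in `K`. -/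
noncomputable def restrictRows (X : PreAbstractSimplicialComplex V) {k : ℤ}
    (K : Finset (X.simplices k)) : (Finset V → ℤ) →ₗ[ℤ] (K → ℤ) :=
  LinearMap.funLeft ℤ ℤ fun σ : K => (σ : X.simplices k).1

theorem supported_inf_ker_restrictRows (X : PreAbstractSimplicialComplex V) {k : ℤ}
    (K : Finset (X.simplices k)) :
    (Pi.supported (X.simplices k)).toAddSubgroup ⊓ (X.restrictRows K).toAddMonoidHom.ker =
      (Pi.supported (Kᶜ.map (Function.Embedding.subtype _))).toAddSubgroup := by
  ext f
  rw [AddSubgroup.mem_inf, Submodule.mem_toAddSubgroup, Submodule.mem_toAddSubgroup,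
    Pi.mem_supported, Pi.mem_supported]
  constructor
  · rintro ⟨h1, h2 : X.restrictRows K f = 0⟩ a ha
    by_cases haX : a ∈ X.simplices k
    · by_cases haK : (⟨a, haX⟩ : X.simplices k) ∈ K
      · exact congrFun h2 (⟨⟨a, haX⟩, haK⟩ : K)
      · exact (ha (Finset.mem_map.mpr ⟨⟨a, haX⟩, Finset.mem_compl.mpr haK, rfl⟩)).elim
    · exact h1 a haX
  · intro h
    constructor
    · intro a ha
      refine h a fun ha' => ha ?_
      obtain ⟨b, _, rfl⟩ := Finset.mem_map.mp ha'
      exact b.2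
    · refine funext fun σ => h _ fun hσ => ?_
      obtain ⟨b, hb, hbσ⟩ := Finset.mem_map.mp hσ
      obtain rfl : b = σ.1 := Subtype.ext hbσ
      exact Finset.mem_compl.mp hb σ.2

theorem map_restrictRows_supported (X : PreAbstractSimplicialComplex V) {k : ℤ}
    (K : Finset (X.simplices k)) :
    (Pi.supported (X.simplices k)).toAddSubgroup.map (X.restrictRows K).toAddMonoidHom = ⊤ := by
  rw [eq_top_iff]
  intro g _
  have hj : Function.Injective (fun σ : K => (σ : X.simplices k).1) :=
    Subtype.val_injective.comp Subtype.val_injective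
  refine ⟨Function.ExtendByZero.linearMap ℤ (fun σ : K => (σ : X.simplices k).1) g, ?_, ?_⟩
  · refine Pi.mem_supported.mpr fun a ha => ?_
    rw [Function.ExtendByZero.linearMap_apply, Function.extend_apply', Pi.zero_apply]
    rintro ⟨σ, rfl⟩
    exact ha σ.1.2
  · exact funext fun σ => hj.extend_apply _ _ σ

/-- The symmetry of `AddSubgroup.relIndex_map_inf_ker_comm` for the boundary and the restriction on
the `k`-chains: the kernels are the cycles and the chains on `Kᶜ`. -/
theorem index_map_restrictRows_cyclesOn (X : PreAbstractSimplicialComplex V) {k : ℤ}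
    (K : Finset (X.simplices k)) :
    ((cyclesOn V (X.simplices k)).map (X.restrictRows K).toAddMonoidHom).index =
      (boundariesOf V (Kᶜ.map (Function.Embedding.subtype _))).relIndex
        (boundariesOf V (X.simplices k)) := by
  rw [← AddSubgroup.relIndex_top_right, ← X.map_restrictRows_supported K, cyclesOn,
    AddSubgroup.relIndex_map_inf_ker_comm, supported_inf_ker_restrictRows]
  rfl

theorem cyclesOn_inf_ker_restrictRows (X : PreAbstractSimplicialComplex V) {k : ℤ}
    (K : Finset (X.simplices k)) :
    cyclesOn V (X.simplices k) ⊓ (X.restrictRows K).toAddMonoidHom.ker =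
      cyclesOn V (Kᶜ.map (Function.Embedding.subtype _)) := by
  rw [cyclesOn, inf_right_comm, supported_inf_ker_restrictRows]
  rfl

theorem restrictRows_fullBoundary_extendByZero (X : PreAbstractSimplicialComplex V) {l k : ℤ}
    (K : Finset (X.simplices l)) {e : K → X.simplices k} (he : Function.Injective e) (v : K → ℤ) :
    X.restrictRows K (fullBoundary V
      (Function.ExtendByZero.linearMap ℤ (fun i => (e i : Finset V)) v)) =
      ((X.boundaryMatrix l k).submatrix (fun σ : K => (σ : X.simplices l)) e).mulVec v := by
  rw [fullBoundary, Matrix.mulVecLin_apply,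
    Matrix.mulVec_extendByZero _ (j := fun i => (e i : Finset V)) (Subtype.val_injective.comp he)]
  rfl

theorem range_extendByZero_enumeration (X : PreAbstractSimplicialComplex V) {ι : Type*}
    [Fintype ι] {k : ℤ} {S : Finset (X.simplices k)} {e : ι → X.simplices k}
    (he : Function.Injective e) (heS : Finset.univ.image e = S) :
    LinearMap.range (Function.ExtendByZero.linearMap ℤ (fun i => (e i : Finset V))) =
      Pi.supported (S.map (Function.Embedding.subtype _)) := by
  rw [Function.ExtendByZero.range_linearMap (j := fun i => (e i : Finset V))
    (Subtype.val_injective.comp he), ← heS,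
    Finset.map_eq_image, Finset.image_image]
  rfl

theorem index_map_restrictRows_boundariesOf (X : PreAbstractSimplicialComplex V) {l k : ℤ}
    (K : Finset (X.simplices l)) {S : Finset (X.simplices k)} {e : K → X.simplices k}
    (he : Function.Injective e) (heS : Finset.univ.image e = S) :
    ((boundariesOf V (S.map (Function.Embedding.subtype _))).map
      (X.restrictRows K).toAddMonoidHom).index =
      ((X.boundaryMatrix l k).submatrix
        (fun σ : K => (σ : X.simplices l)) e).det.natAbs := by
  rw [← Matrix.index_range_mulVecLin, boundariesOf,
    ← X.range_extendByZero_enumeration he heS]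
  congr 1
  ext g
  constructor
  · rintro ⟨_, ⟨_, ⟨v, rfl⟩, rfl⟩, rfl⟩
    exact ⟨v, (X.restrictRows_fullBoundary_extendByZero K he v).symm⟩
  · rintro ⟨v, rfl⟩
    exact ⟨_, ⟨_, ⟨v, rfl⟩, rfl⟩, X.restrictRows_fullBoundary_extendByZero K he v⟩

/-- The absolute value of a maximal minor of the boundary matrix whose complementary rows carry
no cycle. -/
theorem natAbs_det_submatrix_boundaryMatrix (X : PreAbstractSimplicialComplex V) {l k : ℤ}
    (hk : 0 ≤ k) (h : l + 1 = k) {K : Finset (X.simplices l)}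
    (hK : cyclesOn V (Kᶜ.map (Function.Embedding.subtype _)) = ⊥)
    {S : Finset (X.simplices k)} {e : K → X.simplices k}
    (he : Function.Injective e) (heS : Finset.univ.image e = S) :
    ((X.boundaryMatrix l k).submatrix (fun σ : K => (σ : X.simplices l)) e).det.natAbs =
      (boundariesOf V (S.map (Function.Embedding.subtype _))).relIndex
        (cyclesOn V (X.simplices l)) *
      (boundariesOf V (Kᶜ.map (Function.Embedding.subtype _))).relIndex
        (boundariesOf V (X.simplices l)) := by
  have hle : boundariesOf V (S.map (Function.Embedding.subtype _)) ≤
      cyclesOn V (X.simplices l) := by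
    -- Applied to `X_S`, whose `l`-simplices are those of `X`.
    have := (X.faceSubcomplex k S).boundariesOf_le_cyclesOn h
    rwa [X.simplices_faceSubcomplex_self hk, X.simplices_faceSubcomplex_of_lt (by omega)] at this
  rw [← X.index_map_restrictRows_boundariesOf K he heS, ← X.index_map_restrictRows_cyclesOn K,
    ← AddSubgroup.relIndex_mul_index (AddSubgroup.map_mono hle),
    AddSubgroup.relIndex_map_map_of_disjoint_ker _ hle
      ((X.cyclesOn_inf_ker_restrictRows K).trans hK)]

theorem _root_.LinearMap.finrank_map_of_inf_ker_eq_bot {M N : Type*} [AddCommGroup M]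
    [AddCommGroup N]
    (f : M →ₗ[ℤ] N) (A : Submodule ℤ M) (h : A ⊓ LinearMap.ker f = ⊥) :
    Module.finrank ℤ (A.map f) = Module.finrank ℤ A := by
  have hinj : Function.Injective (f.domRestrict A) := by
    rw [← LinearMap.ker_eq_bot, LinearMap.ker_domRestrict, eq_bot_iff]
    exact fun x hx => Subtype.ext (h.le ⟨x.2, hx⟩)
  rw [← LinearMap.finrank_range_of_inj hinj, LinearMap.range_domRestrict]

/-- Every link in `|S| = rk B_S = rk Z = rk r(Z) = |K|` is an injectivity or a finite index: `∂` is
injective on chains on `S`, `B_S` has finite index in the `l`-cycles `Z`, the restriction `r` is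
injective on `Z`, and `r(Z)` has finite index in `ℤ^K`. -/
theorem IsSpanningAcycle.card_eq (X : PreAbstractSimplicialComplex V) {l k : ℤ}
    (hk : 0 ≤ k) (h : l + 1 = k) {K : Finset (X.simplices l)}
    (hK : cyclesOn V (Kᶜ.map (Function.Embedding.subtype _)) = ⊥)
    (hKi : (boundariesOf V (Kᶜ.map (Function.Embedding.subtype _))).relIndex
        (boundariesOf V (X.simplices l)) ≠ 0)
    {S : Finset (X.simplices k)} (hS : X.IsSpanningAcycle k S) : S.card = K.card := by
  obtain ⟨h1, h2⟩ := (X.isSpanningAcycle_iff hk h S).mp hS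
  have hle : boundariesOf V (S.map (Function.Embedding.subtype _)) ≤
      cyclesOn V (X.simplices l) := by
    have := (X.faceSubcomplex k S).boundariesOf_le_cyclesOn h
    rwa [X.simplices_faceSubcomplex_self hk, X.simplices_faceSubcomplex_of_lt (by omega)] at this
  have e1 : Module.finrank ℤ ((Pi.supported (S.map (Function.Embedding.subtype _))).map
      (fullBoundary V)) = S.card := by
    rw [LinearMap.finrank_map_of_inf_ker_eq_bot _ _ (Submodule.toAddSubgroup_injective h1),
      Pi.finrank_supported, Finset.card_map]
  let Z : Submodule ℤ (Finset V → ℤ) :=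
    Pi.supported (X.simplices l) ⊓ LinearMap.ker (fullBoundary V)
  have e2 : Module.finrank ℤ (Z.map (X.restrictRows K)) = Module.finrank ℤ Z :=
    LinearMap.finrank_map_of_inf_ker_eq_bot _ _ (Submodule.toAddSubgroup_injective
      ((X.cyclesOn_inf_ker_restrictRows K).trans hK))
  have hfin : (Z.map (X.restrictRows K)).toAddSubgroup.FiniteIndex :=
    ⟨by rw [← X.index_map_restrictRows_cyclesOn K] at hKi; exact hKi⟩
  have e3 : Module.finrank ℤ (Z.map (X.restrictRows K)) = Module.finrank ℤ (K → ℤ) :=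
    (Z.map (X.restrictRows K)).toAddSubgroup.finrank_eq_of_finiteIndex
  rw [Module.finrank_fintype_fun_eq_card, Fintype.card_coe] at e3
  have hrel : (boundariesOf V (S.map (Function.Embedding.subtype _))).IsFiniteRelIndex
      Z.toAddSubgroup := AddSubgroup.isFiniteRelIndex_iff_relIndex_ne_zero.mpr h2
  have : Module.Finite ℤ Z.toAddSubgroup := inferInstanceAs (Module.Finite ℤ Z)
  have : Module.IsTorsionFree ℤ Z.toAddSubgroup := inferInstanceAs (Module.IsTorsionFree ℤ Z)
  have e4 := AddSubgroup.finrank_eq_of_isFiniteRelIndex (B := Z.toAddSubgroup) hle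
  rw [← e1, ← e3, e2]
  exact e4

theorem det_weightedBoundaryRows_submatrix (X : PreAbstractSimplicialComplex V) (k : ℤ)
    (K : Finset (X.simplices (k - 1))) {S : Finset (X.simplices k)} {e : K → X.simplices k}
    (he : Function.Injective e) (heS : Finset.univ.image e = S) :
    ((X.weightedBoundaryRows k K).submatrix id e).det =
      MvPolynomial.C (((X.boundaryMatrix (k - 1) k).submatrix
        (fun σ : K => (σ : X.simplices (k - 1))) e).det : ℚ) *
        (∏ σ ∈ K, X.xVar k σ) * ∏ η ∈ S, X.yVar k η := by
  have h : (X.weightedBoundaryRows k K).submatrix id e =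
      Matrix.diagonal (fun σ : K => X.xVar k σ) *
        (((X.boundaryMatrix (k - 1) k).submatrix
          (fun σ : K => (σ : X.simplices (k - 1))) e).map
            (Int.castRingHom (MvPolynomial (X.Indet k) ℚ))) *
        Matrix.diagonal (fun i => X.yVar k (e i)) := by
    ext i j
    simp [weightedBoundaryRows, weightedBoundary, Matrix.mul_diagonal, Matrix.diagonal_mul]
  rw [h, Matrix.det_mul, Matrix.det_mul, Matrix.det_diagonal, Matrix.det_diagonal,
    ← RingHom.mapMatrix_apply, ← RingHom.map_det, ← heS, Finset.prod_image he.injOn,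
    Finset.prod_coe_sort K (X.xVar k)]
  simp only [eq_intCast, map_intCast]
  ring

/-- The coefficients of a cycle on `S` form a null vector of the minor. -/
theorem cyclesOn_eq_bot_of_det_ne_zero (X : PreAbstractSimplicialComplex V) {l k : ℤ}
    {K : Finset (X.simplices l)} {S : Finset (X.simplices k)} {e : K → X.simplices k}
    (he : Function.Injective e) (heS : Finset.univ.image e = S)
    (hdet : ((X.boundaryMatrix l k).submatrix
      (fun σ : K => (σ : X.simplices l)) e).det ≠ 0) :
    cyclesOn V (S.map (Function.Embedding.subtype _)) = ⊥ := by
  rw [cyclesOn, ← X.range_extendByZero_enumeration he heS, eq_bot_iff]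
  rintro _ ⟨⟨v, rfl⟩, hv⟩
  have hv' := congrArg (X.restrictRows K) hv
  erw [X.restrictRows_fullBoundary_extendByZero K he v, map_zero] at hv'
  rw [Matrix.eq_zero_of_mulVec_eq_zero hdet hv', map_zero]
  exact AddSubgroup.zero_mem _

end PreAbstractSimplicialComplex

/-! ### The weighted determinant formula -/

theorem mainTheorem4 {V : Type*} [Fintype V] [LinearOrder V] (X : AbstractSimplicialComplex V)
    (d : ℕ) (hd : 1 ≤ d) (hdim : (d : ℤ) ≤ X.dim)
    (K L : Finset (X.simplices ((d : ℤ) - 1)))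
    (hK : (K.card : ℤ) = X.gamma d)
    (hKL : L = Kᶜ) (hL : L ∈ X.spanningAcycles ((d : ℤ) - 1)) :
    (∀ S ∈ X.spanningAcycles d, Finite ((X.faceSubcomplex d S).Homology ((d : ℤ) - 2))) ∧
    (X.weightedBoundaryRows d K * (X.weightedBoundaryRows d K).transpose).det =
      ∑ S ∈ X.spanningAcycles d,
        MvPolynomial.C
          (((Nat.card ((X.faceSubcomplex d S).Homology ((d : ℤ) - 1)) : ℚ) *
              (Nat.card ((X.faceSubcomplex ((d : ℤ) - 1) L).Homology ((d : ℤ) - 2)) : ℚ) /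
            (Nat.card ((X.faceSubcomplex d S).Homology ((d : ℤ) - 2)) : ℚ)) ^ 2) *
          (∏ σ ∈ K, X.xVar d σ) ^ 2 * (∏ η ∈ S, X.yVar d η) ^ 2 := by
  classical
  subst hKL
  have hd0 : (0 : ℤ) ≤ d := by omega
  have hd1 : (0 : ℤ) ≤ (d : ℤ) - 1 := by omega
  have hL' := (X.isSpanningAcycle_iff hd1 (l := (d : ℤ) - 2) (by omega) Kᶜ).mp
    (by simpa [PreAbstractSimplicialComplex.spanningAcycles] using hL)
  obtain ⟨hL1, hL2⟩ := hL'
  -- The tower `∂C_{d-1}(X_L) ≤ ∂C_{d-1}(X) ≤ Z_{d-2}(X)`: its total index is `|H_{d-2}(X_L)|`, and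
  -- its upper index is `|H_{d-2}(X_S)|` for every `S`.
  have hmul := AddSubgroup.relIndex_mul_relIndex _ _ _
    (PreAbstractSimplicialComplex.boundariesOf_mono
      (show Kᶜ.map (Function.Embedding.subtype _) ⊆ X.simplices ((d : ℤ) - 1) by
      intro a ha
      obtain ⟨b, _, rfl⟩ := Finset.mem_map.mp ha
      exact b.2))
    (X.boundariesOf_le_cyclesOn (show (d : ℤ) - 2 + 1 = (d : ℤ) - 1 by omega))
  rw [← hmul] at hL2
  have hKi := left_ne_zero_of_mul hL2
  have hQ := right_ne_zero_of_mul hL2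
  have hcard2 : ∀ S : Finset (X.simplices d),
      Nat.card ((X.faceSubcomplex d S).Homology ((d : ℤ) - 2)) =
      (PreAbstractSimplicialComplex.boundariesOf V (X.simplices ((d : ℤ) - 1))).relIndex
        (PreAbstractSimplicialComplex.cyclesOn V (X.simplices ((d : ℤ) - 2))) := fun S =>
    X.card_homology_faceSubcomplex_of_lt (by omega) (by omega) S
  refine ⟨fun S _ => (Nat.card_ne_zero.mp (by rw [hcard2]; exact hQ)).2, ?_⟩
  have hcardL : Nat.card ((X.faceSubcomplex ((d : ℤ) - 1) Kᶜ).Homology ((d : ℤ) - 2)) = _ :=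
    X.card_homology_faceSubcomplex_pred hd1 (by omega) Kᶜ
  have hcard1 : ∀ S : Finset (X.simplices d),
      Nat.card ((X.faceSubcomplex d S).Homology ((d : ℤ) - 1)) = _ := fun S =>
    X.card_homology_faceSubcomplex_pred hd0 (by omega) S
  have hsub : ∀ S ∈ X.spanningAcycles d,
      S ∈ Finset.powersetCard (Fintype.card K) (Finset.univ : Finset (X.simplices d)) := by
    intro S hS
    rw [Finset.mem_powersetCard, Fintype.card_coe]
    exact ⟨Finset.subset_univ _, PreAbstractSimplicialComplex.IsSpanningAcycle.card_eq
      X.toPreAbstractSimplicialComplex hd0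
      (by omega) hL1 hKi (by simpa [PreAbstractSimplicialComplex.spanningAcycles] using hS)⟩
  -- Extends the sum by zero to all sets of `|K|` columns, the index set of Cauchy–Binet.
  rw [← Finset.inter_eq_right.mpr hsub, ← Finset.sum_ite_mem]
  refine Matrix.det_mul_eq_sum_powersetCard _ _ _ fun e hinj => ?_
  generalize himg : Finset.univ.image e = S
  have hnat := X.natAbs_det_submatrix_boundaryMatrix hd0 (by omega) hL1 hinj himg
  rw [← Matrix.transpose_submatrix, Matrix.det_transpose,
    X.det_weightedBoundaryRows_submatrix d K hinj himg]
  split_ifs with hS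
  -- The factor `|H_{d-2}(X_S)|` cancels from the tower, leaving the absolute value of the minor,
  -- whose sign disappears in the square.
  · rw [hcard1, hcardL, hcard2, ← hmul, Nat.cast_mul, mul_div_assoc,
      mul_div_cancel_right₀ _ (Nat.cast_ne_zero.mpr hQ), ← Nat.cast_mul, ← hnat, Nat.cast_natAbs,
      Int.cast_abs, sq_abs, map_pow]
    ring
  · have hdet : ((X.boundaryMatrix ((d : ℤ) - 1) d).submatrix
        (fun σ : K => (σ : X.simplices ((d : ℤ) - 1))) e).det = 0 := by
      -- A nonzero minor excludes cycles on `S`, and its factor `[Z : B_S]` is then nonzero, so `S`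
      -- would be a spanning acycle.
      by_contra hne
      have : X.IsSpanningAcycle d S :=
        (X.isSpanningAcycle_iff hd0 (l := (d : ℤ) - 1) (by omega) S).mpr
          ⟨X.cyclesOn_eq_bot_of_det_ne_zero hinj himg hne,
            left_ne_zero_of_mul (hnat ▸ Int.natAbs_ne_zero.mpr hne)⟩
      exact hS (by simpa [PreAbstractSimplicialComplex.spanningAcycles] using this)
    rw [hdet]
    simp
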